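/- Let $W$ be a group with a finite generating set $S=\{s_1,\dots,s_r\}$ and a presentation $W=\langle S\mid (s_is_j)^{m_{ij}}=1 \text{ for all } i,j \text{ with } m_{ij}\neq\infty\rangle$, where $m_{ii}=1$ and $m_{ij}=m_{ji}\in\{2,3,\dots\}\cup\{\infty\}$ for $i\ne j$ (a Coxeter system). Assume that $W$ is odd-angled, i.e. every $m_{ij}$ is odd or infinite, and that its divisibility diagram $\mathrm{Cox}_{\mathrm{div}}(W)$ is connected; this is the graph with vertex set $S$ in which distinct $s_i,s_j$ are joined, by an edge labelled with the least divisor of $m_{ij}$ greater than $1$, if and only if $m_{ij}<\infty$. For a group $G$ with a given generating set, a reflection is a conjugate in $G$ of a generator, and a reflection subgroup is a proper subgroup of $G$ (i.e. of index greater than $1$) generated by a set of reflections; the empty set is allowed, so that the trivial subgroup is a reflection subgroup when $G\neq 1$. Suppose that $W$ has a reflection subgroup $V\subsetneq W$ of index $n$ with $1<n<\infty$. Let $W_1=\langle S'\rangle$ be the special subgroup of $W$ generated by a non-empty subset $S'\subseteq S$. Then $W_1$, with generating set $S'$, contains a (proper) reflection subgroup $U$ of finite index $1<[W_1:U]\le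 n$. -/

import Mathlib

namespace OddAngled

/-- A Coxeter matrix is odd-angled if all its entries are odd or infinite
(Mathlib writes `0` for an infinite entry). -/
def IsOddAngled {B : Type*} (M : CoxeterMatrix B) : Prop :=
  ∀ i j : B, M i j = 0 ∨ Odd (M i j)

/-- The graph underlying the divisibility diagram. The vertices are the generators; two distinct
vertices are joined when `m i j` is finite, and such an edge carries as its label the least
non-trivial divisor `(M i j).minFac` of `m i j`. Connectedness of the diagram does not involve the
labels. -/
def divDiagram {B : Type*} (M : CoxeterMatrix B) : SimpleGraph B where
  Adj i j := i ≠ j ∧ M i j ≠ 0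
  symm := ⟨fun i j h => ⟨h.1.symm, by rw [M.symmetric]; exact h.2⟩⟩
  loopless := ⟨fun _ h => h.1 rfl⟩

/-- The reflections of a group `G` with respect to a set `S` of generators: the conjugates in `G`
of the elements of `S`. -/
def reflections {G : Type*} [Group G] (S : Set G) : Set G :=
  {t | ∃ s ∈ S, IsConj s t}

/-- For a Coxeter system these are Mathlib's reflections. -/
theorem mem_reflections_range_simple {B W : Type*} [Group W] {M : CoxeterMatrix B}
    (cs : CoxeterSystem M W) (t : W) :
    t ∈ reflections (Set.range cs.simple) ↔ cs.IsReflection t := by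
  simp only [reflections, CoxeterSystem.IsReflection, Set.mem_ofPred_eq, Set.exists_range_iff,
    isConj_iff]
  constructor
  · rintro ⟨i, w, h⟩
    exact ⟨w, i, h.symm⟩
  · rintro ⟨w, i, h⟩
    exact ⟨i, w, h.symm⟩

/-- A reflection subgroup of `(G, S)`: a proper subgroup generated by a (possibly empty) set of
reflections. -/
def IsReflectionSubgroup {G : Type*} [Group G] (S : Set G) (V : Subgroup G) : Prop :=
  V ≠ ⊤ ∧ ∃ T : Set G, T ⊆ reflections S ∧ Subgroup.closure T = V

/-- The special subgroup generated by a set `S'` of generating reflections. -/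
abbrev specialSubgroup {W : Type*} [Group W] (S' : Set W) : Subgroup W :=
  Subgroup.closure S'

/-- The set `S'`, regarded as the generating set of the special subgroup that it generates. -/
def specialGenerators {W : Type*} [Group W] (S' : Set W) : Set (specialSubgroup S') :=
  {x | (x : W) ∈ S'}

end OddAngled

/-!
Generators `sᵢ`, `sⱼ` with `m i j` odd are conjugate, so all simple reflections are conjugate and
some conjugate `V'` of `V`, again a reflection subgroup, misses a given `s ∈ S'`. Then `U = V' ∩ W₁`
is a proper subgroup of `W₁` of index at most `[W : V']`, and the point is that `U` is generated by
reflections of `W₁`.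

Let `w ∈ U` be the product of a word in `S'`. If some `t ∈ V'` is a left inversion of `w`, then by
strong exchange `t` is a reflection of `W₁` and `t * w ∈ U` is the product of a shorter word. If no
element of `V'` is a left inversion of `w`, then `w = 1`: following Dyer, `V'` is generated by its
elements `c` whose only left inversion in `V'` is `c`, and strong exchange holds for words in these
generators too, so that a product with no left inversion in `V'` must be `1`.
-/

namespace OddAngled

section InversionParity

variable {B W : Type*} [Group W] {M : CoxeterMatrix B} (cs : CoxeterSystem M W)

theorem conj_apply_eq_self_iff {G : Type*} [Group G] {g t : G} :
    MulAut.conj g t = g ↔ t = g := by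
  rw [MulAut.conj_apply, mul_inv_eq_iff_eq_mul, mul_right_inj]

open Classical in
/-- The action of a simple reflection on signed reflections: conjugation by `sᵢ`, with a change of
sign exactly at `sᵢ` itself. It is defined on all of `W × ZMod 2`, so that no subtype of reflections
is needed. -/
noncomputable def signedConj (i : B) : Equiv.Perm (W × ZMod 2) :=
  Function.Involutive.toPerm
    (fun p => (MulAut.conj (cs.simple i) p.1, p.2 + if p.1 = cs.simple i then 1 else 0)) <| by
      rintro ⟨t, e⟩
      simp only [conj_apply_eq_self_iff, add_assoc, CharTwo.add_self_eq_zero, add_zero]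
      simp [mul_assoc]

open Classical in
theorem signedConj_apply (i : B) (t : W) (e : ZMod 2) :
    signedConj cs i (t, e) =
      (MulAut.conj (cs.simple i) t, e + if t = cs.simple i then 1 else 0) :=
  rfl

open Classical in
theorem prod_map_signedConj_reverse_apply (ω : List B) (t : W) (e : ZMod 2) :
    (ω.reverse.map (signedConj cs)).prod (t, e) =
      (MulAut.conj (cs.wordProd ω)⁻¹ t, e + ((cs.leftInvSeq ω).count t : ZMod 2)) := by
  induction ω generalizing t e with
  | nil => simp
  | cons i ω ih =>
    have hcount : ((cs.leftInvSeq ω).map (MulAut.conj (cs.simple i))).count t =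
        (cs.leftInvSeq ω).count (MulAut.conj (cs.simple i) t) := by
      rw [← List.count_map_of_injective _ _ (MulAut.conj (cs.simple i)).injective
        (MulAut.conj (cs.simple i) t)]
      simp [mul_assoc]
    simp only [List.reverse_cons, List.map_append, List.map_cons, List.map_nil, List.prod_append,
      List.prod_singleton, Equiv.Perm.mul_apply, signedConj_apply, ih, Prod.mk.injEq]
    refine ⟨by simp [CoxeterSystem.wordProd_cons, mul_assoc], ?_⟩
    rw [CoxeterSystem.leftInvSeq, List.count_cons, hcount]
    split_ifs <;> simp_all [add_comm, add_left_comm]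

theorem prod_map_reverse_alternatingWord {G : Type*} [Monoid G] (f : B → G) (i j : B) (m : ℕ) :
    ((CoxeterSystem.alternatingWord i j (2 * m)).reverse.map f).prod = (f j * f i) ^ m := by
  induction m with
  | zero => simp [CoxeterSystem.alternatingWord]
  | succ m ih =>
    rw [mul_add_one, CoxeterSystem.alternatingWord_succ, CoxeterSystem.alternatingWord_succ,
      pow_succ', ← ih]
    simp [mul_assoc]

/-- The two halves of the sequence coincide, because `(sⱼ * sᵢ) ^ M i j = 1`. -/
theorem even_count_leftInvSeq_alternatingWord [DecidableEq W] (i j : B) (t : W) :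
    Even ((cs.leftInvSeq (CoxeterSystem.alternatingWord i j (2 * M i j))).count t) := by
  set l := cs.leftInvSeq (CoxeterSystem.alternatingWord i j (2 * M i j)) with hl
  have hlen : l.length = 2 * M i j := by simp [hl]
  have hget (k : ℕ) (hk : k < l.length) :
      l[k] = cs.simple i * (cs.simple j * cs.simple i) ^ k := by
    simp only [hl, cs.getElem_leftInvSeq_alternatingWord i j _ k (hlen ▸ hk),
      cs.prod_alternatingWord_eq_mul_pow]
    rw [if_neg (by simp), show (2 * k + 1) / 2 = k by lia]
  have hhalves : l.drop (M i j) = l.take (M i j) := by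
    refine List.ext_getElem (by grind) fun k _ _ => ?_
    rw [List.getElem_drop, List.getElem_take, hget, hget, pow_add, cs.simple_mul_simple_pow',
      one_mul]
  rw [← List.take_append_drop (M i j) l, List.count_append, hhalves]
  exact ⟨_, rfl⟩

theorem isLiftable_signedConj : M.IsLiftable (signedConj cs) := by
  classical
  intro i j
  have hword : cs.wordProd (CoxeterSystem.alternatingWord j i (2 * M j i)) = 1 := by
    simp [cs.prod_alternatingWord_eq_mul_pow]
  ext1 ⟨t, e⟩
  rw [M.symmetric i j, ← prod_map_reverse_alternatingWord, prod_map_signedConj_reverse_apply,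
    hword, (ZMod.natCast_eq_zero_iff_even).2 (even_count_leftInvSeq_alternatingWord cs j i t)]
  simp

/-- The parity of the number of times `t` occurs in the left inversion sequence of a word for `w`
(see `inversionParity_wordProd`): it is `1` when `t` is a left inversion of `w`, and `0` otherwise,
in particular when `t` is not a reflection. -/
noncomputable def inversionParity (w t : W) : ZMod 2 :=
  (cs.lift ⟨signedConj cs, isLiftable_signedConj cs⟩ w⁻¹ (t, 0)).2

open Classical in
theorem lift_signedConj_inv_wordProd_apply (ω : List B) (t : W) (e : ZMod 2) :
    cs.lift ⟨signedConj cs, isLiftable_signedConj cs⟩ (cs.wordProd ω)⁻¹ (t, e) =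
      (MulAut.conj (cs.wordProd ω)⁻¹ t, e + ((cs.leftInvSeq ω).count t : ZMod 2)) := by
  rw [← prod_map_signedConj_reverse_apply, ← cs.wordProd_reverse, CoxeterSystem.wordProd,
    map_list_prod, List.map_map]
  congr 3
  ext1 i
  exact cs.lift_apply_simple (isLiftable_signedConj cs) i

open Classical in
theorem inversionParity_wordProd (ω : List B) (t : W) :
    inversionParity cs (cs.wordProd ω) t = ((cs.leftInvSeq ω).count t : ZMod 2) := by
  rw [inversionParity, lift_signedConj_inv_wordProd_apply, zero_add]

theorem inversionParity_mul (x y t : W) :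
    inversionParity cs (x * y) t =
      inversionParity cs x t + inversionParity cs y (x⁻¹ * t * x) := by
  obtain ⟨ω, rfl⟩ := cs.wordProd_surjective x
  obtain ⟨ω', rfl⟩ := cs.wordProd_surjective y
  rw [inversionParity, mul_inv_rev, map_mul, Equiv.Perm.mul_apply,
    lift_signedConj_inv_wordProd_apply, lift_signedConj_inv_wordProd_apply,
    inversionParity_wordProd, inversionParity_wordProd]
  simp

theorem inversionParity_one (t : W) : inversionParity cs 1 t = 0 := by
  simpa using inversionParity_wordProd cs [] t

theorem inversionParity_simple_ne_zero_iff {i : B} {t : W} :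
    inversionParity cs (cs.simple i) t ≠ 0 ↔ t = cs.simple i := by
  classical
  have h := inversionParity_wordProd cs [i] t
  rw [cs.wordProd_singleton, cs.leftInvSeq_singleton, List.count_singleton] at h
  rw [h, eq_comm (a := t)]
  simp

theorem isReflection_of_inversionParity_ne_zero {w t : W} (h : inversionParity cs w t ≠ 0) :
    cs.IsReflection t := by
  classical
  obtain ⟨ω, rfl⟩ := cs.wordProd_surjective w
  refine cs.isReflection_of_mem_leftInvSeq ω (List.count_pos_iff.1 (Nat.pos_of_ne_zero ?_))
  exact fun h0 => h (by rw [inversionParity_wordProd, h0, Nat.cast_zero])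

end InversionParity

section CanonicalReflections

variable {B W : Type*} [Group W] {M : CoxeterMatrix B} (cs : CoxeterSystem M W)

/-- Dyer's canonical generators of a subgroup `V`: the elements of `V` that are their own only
inversion in `V`. They are reflections by `isReflection_of_mem_canonicalReflections`. -/
def canonicalReflections (V : Subgroup W) : Set W :=
  {c | c ∈ V ∧ ∀ t ∈ V, inversionParity cs c t ≠ 0 ↔ t = c}

variable {cs} {V : Subgroup W}

theorem isReflection_of_mem_canonicalReflections {c : W} (hc : c ∈ canonicalReflections cs V) :
    cs.IsReflection c :=
  isReflection_of_inversionParity_ne_zero cs ((hc.2 c hc.1).2 rfl)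

theorem simple_mem_canonicalReflections {i : B} (hi : cs.simple i ∈ V) :
    cs.simple i ∈ canonicalReflections cs V :=
  ⟨hi, fun _ _ => inversionParity_simple_ne_zero_iff cs⟩

/-- The strong exchange condition; for `W` itself it is the case `V = ⊤`. -/
theorem exists_eq_append_cons_of_inversionParity_ne_zero {L : List W}
    (hL : ∀ c ∈ L, c ∈ canonicalReflections cs V) {t : W} (ht : t ∈ V)
    (hLt : inversionParity cs L.prod t ≠ 0) :
    ∃ L₁ c L₂, L = L₁ ++ c :: L₂ ∧ t = L₁.prod * c * L₁.prod⁻¹ := by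
  induction L generalizing t with
  | nil => exact absurd (inversionParity_one cs t) hLt
  | cons d L ih =>
    obtain ⟨hd, hL⟩ := List.forall_mem_cons.1 hL
    by_cases htd : t = d
    · exact ⟨[], d, L, rfl, by simp [htd]⟩
    · have hdt : inversionParity cs d t = 0 := not_ne_iff.1 (mt (hd.2 t ht).1 htd)
      rw [List.prod_cons, inversionParity_mul, hdt, zero_add] at hLt
      obtain ⟨L₁, c, L₂, rfl, hconj⟩ := ih hL (mul_mem (mul_mem (inv_mem hd.1) ht) hd.1) hLt
      refine ⟨d :: L₁, c, L₂, rfl, ?_⟩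
      calc t = d * (d⁻¹ * t * d) * d⁻¹ := by group
        _ = (d :: L₁).prod * c * (d :: L₁).prod⁻¹ := by rw [hconj, List.prod_cons]; group

theorem conj_prod_mul_prod_append_cons {G : Type*} [Group G] (L₁ L₂ : List G) {c : G}
    (hc : c * c = 1) :
    L₁.prod * c * L₁.prod⁻¹ * (L₁ ++ c :: L₂).prod = (L₁ ++ L₂).prod := by
  simp only [List.prod_append, List.prod_cons, mul_assoc, inv_mul_cancel_left]
  rw [← mul_assoc c, hc, one_mul]

theorem exists_list_of_mem_closure_of_mul_self {G : Type*} [Group G] {S : Set G}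
    (hS : ∀ s ∈ S, s * s = 1) {x : G} (hx : x ∈ Subgroup.closure S) :
    ∃ L : List G, (∀ s ∈ L, s ∈ S) ∧ L.prod = x := by
  have hinv : S⁻¹ ⊆ S := fun s hs => by
    rwa [← inv_inv s, inv_eq_of_mul_eq_one_right (hS _ hs)]
  rw [← Subgroup.mem_toSubmonoid, Subgroup.closure_toSubmonoid, Set.union_eq_left.2 hinv] at hx
  exact Submonoid.exists_list_of_mem_closure hx

theorem prod_eq_one_of_forall_inversionParity_eq_zero (L : List W)
    (hL : ∀ c ∈ L, c ∈ canonicalReflections cs V)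
    (hzero : ∀ t ∈ V, inversionParity cs L.prod t = 0) : L.prod = 1 := by
  match L with
  | [] => rfl
  | d :: L =>
    obtain ⟨hd, hL⟩ := List.forall_mem_cons.1 hL
    have hLd : inversionParity cs L.prod d ≠ 0 := fun h => by
      have hzero_d := hzero d hd.1
      rw [List.prod_cons, inversionParity_mul, inv_mul_cancel, one_mul, h, add_zero] at hzero_d
      exact (hd.2 d hd.1).2 rfl hzero_d
    obtain ⟨L₁, c, L₂, rfl, hconj⟩ :=
      exists_eq_append_cons_of_inversionParity_ne_zero hL hd.1 hLd
    have hcancel : (d :: (L₁ ++ c :: L₂)).prod = (L₁ ++ L₂).prod := by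
      rw [List.prod_cons, hconj, conj_prod_mul_prod_append_cons]
      exact (isReflection_of_mem_canonicalReflections (hL c (by simp))).mul_self
    rw [hcancel] at hzero ⊢
    exact prod_eq_one_of_forall_inversionParity_eq_zero (L₁ ++ L₂)
      (fun x hx => hL x (by simp only [List.mem_append, List.mem_cons] at hx ⊢; tauto)) hzero
  termination_by L.length
  decreasing_by subst_vars; simp

theorem eq_one_of_mem_closure_canonicalReflections {v : W}
    (hv : v ∈ Subgroup.closure (canonicalReflections cs V))
    (hzero : ∀ t ∈ V, inversionParity cs v t = 0) : v = 1 := by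
  obtain ⟨L, hL, rfl⟩ := exists_list_of_mem_closure_of_mul_self
    (fun c hc => (isReflection_of_mem_canonicalReflections hc).mul_self) hv
  exact prod_eq_one_of_forall_inversionParity_eq_zero L hL hzero

open scoped Pointwise

/-- Conjugating by a simple reflection outside `V` changes inversions only at that reflection. -/
theorem conj_smul_canonicalReflections_subset {j : B} (hj : cs.simple j ∉ V) :
    MulAut.conj (cs.simple j) • canonicalReflections cs V ⊆
      canonicalReflections cs (MulAut.conj (cs.simple j) • V) := by
  rintro _ ⟨c, ⟨hcV, hc⟩, rfl⟩
  refine ⟨Subgroup.smul_mem_pointwise_smul _ _ _ hcV, ?_⟩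
  rintro _ ⟨t, ht, rfl⟩
  have hzero {x : W} (hx : x ∈ V) : inversionParity cs (cs.simple j) x = 0 :=
    not_ne_iff.1 fun h => hj ((inversionParity_simple_ne_zero_iff cs).1 h ▸ hx)
  have hzero_conj : inversionParity cs (cs.simple j) (MulAut.conj (cs.simple j) t) = 0 :=
    not_ne_iff.1 fun h => hj <|
      conj_apply_eq_self_iff.1 ((inversionParity_simple_ne_zero_iff cs).1 h) ▸ ht
  have hparity : inversionParity cs (MulAut.conj (cs.simple j) c) (MulAut.conj (cs.simple j) t) =
      inversionParity cs c t := by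
    calc _ = inversionParity cs (cs.simple j * (c * cs.simple j))
          (MulAut.conj (cs.simple j) t) := by
          rw [MulAut.conj_apply, cs.inv_simple, mul_assoc]
      _ = inversionParity cs (c * cs.simple j) t := by
          rw [inversionParity_mul, hzero_conj, zero_add]
          simp [mul_assoc]
      _ = inversionParity cs c t := by
          rw [inversionParity_mul, hzero (mul_mem (mul_mem (inv_mem hcV) ht) hcV), add_zero]
  exact (hparity ▸ hc t ht).trans (MulAut.conj (cs.simple j)).injective.eq_iff.symm

theorem mem_closure_canonicalReflections_of_isReflection {t : W} (ht : cs.IsReflection t)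
    (htV : t ∈ V) : t ∈ Subgroup.closure (canonicalReflections cs V) := by
  obtain ⟨w, i, rfl⟩ := ht
  have simple_mem {V : Subgroup W} {j : B} (hj : cs.simple j ∈ V) :
      cs.simple j ∈ Subgroup.closure (canonicalReflections cs V) :=
    Subgroup.subset_closure (simple_mem_canonicalReflections hj)
  induction w using cs.simple_induction_left generalizing V with
  | one => simpa using simple_mem (by simpa using htV)
  | mul_simple_left w j ih =>
    set s := cs.simple j
    have hconj : s * w * cs.simple i * (s * w)⁻¹ = MulAut.conj s • (w * cs.simple i * w⁻¹) := by
      simp [mul_assoc]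
    rw [hconj] at htV ⊢
    by_cases hj : s ∈ V
    · rw [MulAut.smul_def, MulAut.conj_apply] at htV ⊢
      rw [Subgroup.mul_mem_cancel_right _ (inv_mem hj), Subgroup.mul_mem_cancel_left _ hj] at htV
      exact mul_mem (mul_mem (simple_mem hj) (ih htV)) (inv_mem (simple_mem hj))
    · have hinvol : MulAut.conj s • MulAut.conj s • V = V := by
        rw [smul_smul, ← map_mul, cs.simple_mul_simple_self, map_one, one_smul]
      have mem_conj_iff (x : W) : x ∈ MulAut.conj s • V ↔ MulAut.conj s • x ∈ V := by
        rw [← Subgroup.smul_mem_pointwise_smul_iff (a := MulAut.conj s), hinvol]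
      have hsubset := conj_smul_canonicalReflections_subset (V := MulAut.conj s • V) (j := j) <| by
        rwa [mem_conj_iff, MulAut.smul_def, conj_apply_eq_self_iff.2 rfl]
      rw [hinvol] at hsubset
      refine Subgroup.closure_mono hsubset ?_
      rw [← Subgroup.smul_closure]
      exact Subgroup.smul_mem_pointwise_smul _ _ _ (ih ((mem_conj_iff _).2 htV))

theorem closure_canonicalReflections_eq {T : Set W} (hT : ∀ t ∈ T, cs.IsReflection t) :
    Subgroup.closure (canonicalReflections cs (Subgroup.closure T)) = Subgroup.closure T := by
  refine le_antisymm ((Subgroup.closure_le _).2 fun c hc => hc.1) ((Subgroup.closure_le _).2 ?_)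
  exact fun t ht =>
    mem_closure_canonicalReflections_of_isReflection (hT t ht) (Subgroup.subset_closure ht)

end CanonicalReflections

section SpecialSubgroup

variable {B W : Type*} [Group W] {M : CoxeterMatrix B} {cs : CoxeterSystem M W}

theorem conj_mem_reflections_specialGenerators {S' : Set W} {s u : W} (hs : s ∈ S')
    (hu : u ∈ specialSubgroup S') :
    ∃ t ∈ reflections (specialGenerators S'), (t : W) = u * s * u⁻¹ := by
  let s' : specialSubgroup S' := ⟨s, Subgroup.subset_closure hs⟩
  let u' : specialSubgroup S' := ⟨u, hu⟩
  exact ⟨u' * s' * u'⁻¹, ⟨s', hs, isConj_iff.2 ⟨u', rfl⟩⟩, rfl⟩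

theorem mem_closure_reflections_of_prod_mem {T S' : Set W} (hT : ∀ t ∈ T, cs.IsReflection t)
    (hS' : S' ⊆ Set.range cs.simple) (L : List W) (hL : ∀ s ∈ L, s ∈ S')
    (hLT : L.prod ∈ Subgroup.closure T) (x : specialSubgroup S') (hx : (x : W) = L.prod) :
    x ∈ Subgroup.closure
      {t | t ∈ reflections (specialGenerators S') ∧ (t : W) ∈ Subgroup.closure T} := by
  by_cases hzero : ∀ t ∈ Subgroup.closure T, inversionParity cs L.prod t = 0
  · have hx1 : (x : W) = 1 := hx.trans <|
      eq_one_of_mem_closure_canonicalReflections ((closure_canonicalReflections_eq hT).ge hLT) hzero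
    rw [OneMemClass.coe_eq_one.1 hx1]
    exact one_mem _
  · push Not at hzero
    obtain ⟨t, htT, ht⟩ := hzero
    have hcan : ∀ s ∈ L, s ∈ canonicalReflections cs ⊤ := fun s hs => by
      obtain ⟨i, rfl⟩ := hS' (hL s hs)
      exact simple_mem_canonicalReflections (Subgroup.mem_top _)
    obtain ⟨L₁, c, L₂, rfl, rfl⟩ :=
      exists_eq_append_cons_of_inversionParity_ne_zero hcan (Subgroup.mem_top t) ht
    have hcancel := conj_prod_mul_prod_append_cons L₁ L₂
      (isReflection_of_mem_canonicalReflections (hcan c (by simp))).mul_self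
    obtain ⟨t', ht', hcoe⟩ := conj_mem_reflections_specialGenerators (hL c (by simp))
      (list_prod_mem fun s hs => Subgroup.subset_closure (hL s (by simp [hs])) :
        L₁.prod ∈ specialSubgroup S')
    rw [← hcoe] at htT hcancel
    have ht'mem : t' ∈ Subgroup.closure
        {t | t ∈ reflections (specialGenerators S') ∧ (t : W) ∈ Subgroup.closure T} :=
      Subgroup.subset_closure ⟨ht', htT⟩
    rw [← Subgroup.mul_mem_cancel_left _ ht'mem]
    refine mem_closure_reflections_of_prod_mem hT hS' (L₁ ++ L₂)
      (fun s hs => hL s (by simp only [List.mem_append, List.mem_cons] at hs ⊢; tauto))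
      (hcancel ▸ mul_mem htT hLT) _ ?_
    rw [Subgroup.coe_mul, hx, hcancel]
  termination_by L.length
  decreasing_by subst_vars; simp

theorem closure_reflections_eq_subgroupOf_specialSubgroup {T S' : Set W}
    (hT : ∀ t ∈ T, cs.IsReflection t) (hS' : S' ⊆ Set.range cs.simple) :
    Subgroup.closure
        {t | t ∈ reflections (specialGenerators S') ∧ (t : W) ∈ Subgroup.closure T} =
      (Subgroup.closure T).subgroupOf (specialSubgroup S') := by
  refine le_antisymm ((Subgroup.closure_le _).2 fun t ht => ht.2) fun x hx => ?_
  have hsq : ∀ s ∈ S', s * s = 1 := fun s hs => by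
    obtain ⟨i, rfl⟩ := hS' hs
    exact cs.simple_mul_simple_self i
  obtain ⟨L, hL, hLx⟩ := exists_list_of_mem_closure_of_mul_self hsq x.2
  exact mem_closure_reflections_of_prod_mem hT hS' L hL (hLx ▸ hx) x hLx.symm

theorem IsReflectionSubgroup.subgroupOf_specialSubgroup {V : Subgroup W}
    (hV : IsReflectionSubgroup (Set.range cs.simple) V) {S' : Set W}
    (hS' : S' ⊆ Set.range cs.simple) (hS'V : ¬ S' ⊆ V) :
    IsReflectionSubgroup (specialGenerators S') (V.subgroupOf (specialSubgroup S')) := by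
  obtain ⟨-, T, hT, rfl⟩ := hV
  refine ⟨?_, _, fun t ht => ht.1, closure_reflections_eq_subgroupOf_specialSubgroup
    (fun t ht => (mem_reflections_range_simple cs t).1 (hT ht)) hS'⟩
  rwa [Ne, Subgroup.subgroupOf_eq_top, Subgroup.closure_le]

end SpecialSubgroup

section Conjugacy

open scoped Pointwise

theorem IsReflectionSubgroup.conj_smul {G : Type*} [Group G] {S : Set G} {V : Subgroup G}
    (hV : IsReflectionSubgroup S V) (g : G) : IsReflectionSubgroup S (MulAut.conj g • V) := by
  obtain ⟨hVtop, T, hT, rfl⟩ := hV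
  refine ⟨fun h => hVtop ?_, MulAut.conj g • T, ?_, (Subgroup.smul_closure _ T).symm⟩
  · rw [← smul_left_cancel_iff (MulAut.conj g), h, Subgroup.Normal.conj_smul_eq_self]
  · rintro _ ⟨t, ht, rfl⟩
    obtain ⟨s, hs, hst⟩ := hT ht
    exact ⟨s, hs, hst.trans (isConj_iff.2 ⟨g, rfl⟩)⟩

variable {B W : Type*} [Group W] {M : CoxeterMatrix B} (cs : CoxeterSystem M W)

theorem exists_simple_notMem {V : Subgroup W} (hV : V ≠ ⊤) : ∃ i, cs.simple i ∉ V := by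
  contrapose! hV
  rw [eq_top_iff, ← cs.subgroup_closure_range_simple, Subgroup.closure_le]
  exact Set.range_subset_iff.2 hV

theorem isConj_simple_of_odd {i j : B} (h : Odd (M i j)) :
    IsConj (cs.simple i) (cs.simple j) := by
  obtain ⟨k, hk⟩ := h
  set r := cs.simple i * cs.simple j with hr
  have hinv : (r ^ k)⁻¹ = (cs.simple j * cs.simple i) ^ k := by simp [hr, ← inv_pow]
  have hpow : r * r ^ (2 * k) = 1 := by rw [← pow_succ', ← hk, cs.simple_mul_simple_pow]
  refine isConj_iff.2 ⟨r ^ k, ?_⟩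
  calc r ^ k * cs.simple i * (r ^ k)⁻¹ = r ^ k * (r ^ k * cs.simple i) := by
        rw [hinv, mul_assoc, ← mul_pow_mul]
    _ = r⁻¹ * cs.simple i := by
        rw [← mul_assoc, ← pow_add, ← two_mul, inv_eq_of_mul_eq_one_right hpow]
    _ = cs.simple j := by simp [hr]

theorem isConj_simple (hodd : IsOddAngled M) (hconn : (divDiagram M).Connected) (i j : B) :
    IsConj (cs.simple i) (cs.simple j) := by
  obtain ⟨p⟩ := hconn.preconnected i j
  induction p with
  | nil => exact IsConj.refl _
  | cons h _ ih => exact (isConj_simple_of_odd cs ((hodd _ _).resolve_left h.2)).trans ih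

end Conjugacy

end OddAngled

open OddAngled Pointwise in
theorem corollary3p2_general {B W : Type*} [Group W] {M : CoxeterMatrix B}
    (cs : CoxeterSystem M W) (hconj : ∀ i j, IsConj (cs.simple i) (cs.simple j))
    {V : Subgroup W} (hV : IsReflectionSubgroup (Set.range cs.simple) V) [V.FiniteIndex]
    {S' : Set W} (hS' : S' ⊆ Set.range cs.simple) (hne : S'.Nonempty) :
    ∃ U : Subgroup (specialSubgroup S'),
      IsReflectionSubgroup (specialGenerators S') U ∧ 1 < U.index ∧ U.index ≤ V.index := by
  obtain ⟨j, hj⟩ := exists_simple_notMem cs hV.1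
  obtain ⟨s, hs⟩ := hne
  obtain ⟨i, rfl⟩ := hS' hs
  obtain ⟨g, hg⟩ := isConj_iff.1 (hconj j i)
  set V' := MulAut.conj g • V
  have hi : cs.simple i ∉ V' := by
    rwa [← hg, ← MulAut.conj_apply, ← MulAut.smul_def, Subgroup.smul_mem_pointwise_smul_iff]
  have hindex : V'.index = V.index := Subgroup.index_map_equiv V (MulAut.conj g)
  have : V'.FiniteIndex := ⟨hindex ▸ Subgroup.FiniteIndex.index_ne_zero⟩
  have hrel : V'.relIndex ⊤ = V.index := V'.relIndex_top_right.trans hindex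
  have hU := (hV.conj_smul g).subgroupOf_specialSubgroup hS' fun h => hi (h hs)
  refine ⟨V'.subgroupOf (specialSubgroup S'), hU, Subgroup.one_lt_index_of_ne_top hU.1, ?_⟩
  exact hrel ▸ Subgroup.relIndex_le_of_le_right le_top
    (hrel.trans_ne Subgroup.FiniteIndex.index_ne_zero)

theorem corollary3p2 {B W : Type*} [Finite B] [Group W] {M : CoxeterMatrix B}
    (cs : CoxeterSystem M W)
    (hodd : OddAngled.IsOddAngled M)
    (hconn : (OddAngled.divDiagram M).Connected)
    (n : ℕ) (hn : 1 < n)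
    (V : Subgroup W)
    (hV : OddAngled.IsReflectionSubgroup (Set.range cs.simple) V)
    (hVn : V.index = n)
    (S' : Set W) (hS' : S' ⊆ Set.range cs.simple) (hne : S'.Nonempty) :
    ∃ U : Subgroup (OddAngled.specialSubgroup S'),
      OddAngled.IsReflectionSubgroup (OddAngled.specialGenerators S') U ∧
        1 < U.index ∧ U.index ≤ n := by
  have : V.FiniteIndex := ⟨by lia⟩
  exact hVn ▸ corollary3p2_general cs (OddAngled.isConj_simple cs hodd hconn) hV hS' hne
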